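/- Write $\epsilon = t\frac{d}{dt}$. Formal differential operators $\sum_k u_k(t)\,\epsilon^k$ (finite sums, $u_k\in\mathbb C[[t]]$) are composed by means of the rule $\epsilon u = u\,\epsilon + \epsilon(u)$ for $u\in\mathbb C[[t]]$; the order is the degree in $\epsilon$. Such an operator is called formal Fuchsian if its leading coefficient (the coefficient of the highest power of $\epsilon$) does not vanish at $t=0$, and Fuchsian if, moreover, all of its coefficients converge, i.e. lie in the ring $\mathcal O(\mathbb C,0)$ of germs of holomorphic functions at the origin; $\mathcal F$ denotes the set of Fuchsian operators. Theorem. Let $L=\sum_{k=0}^n a_k(t)\epsilon^k$ and $M=\sum_{k=0}^n b_k(t)\epsilon^k$ be two Fuchsian operators of the same order $n$, so $a_k,b_k\in\mathcal O(\mathbb C,0)$ and $a_n(0)b_n(0)\neq 0$. Let $H=\sum_{k=0}^{n-1}u_k(t)\epsilon^k$ and $K=\sum_{k=0}^{n-1}v_k(t)\epsilon^k$, with $u_k,v_k\in\mathbb C[[t]]$, be two formal Fuchsian operators of order at most $n-1$ such that $MH=KL$. Then all the formal series $u_k$, $v_k$ converge, hence $H,K\in\mathcal F$. -/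

import Mathlib

noncomputable section

/-- The Euler derivation `t · d/dt` of the ring `ℂ⟦t⟧`. -/
def eulerDeriv (f : PowerSeries ℂ) : PowerSeries ℂ :=
  PowerSeries.X * PowerSeries.derivative ℂ f

/-- Formal differential operators `∑ k, u_k(t) ε^k`, `u_k ∈ ℂ⟦t⟧`, where `ε = t · d/dt`: they are
written, with the coefficients to the left of the powers of `ε`, as polynomials in the symbol `ε`.
The order is the degree in `ε`, and the sum is the sum of polynomials.  The composition of
operators is `opMul` below, not the commutative product of polynomials. -/
abbrev FormalOp : Type := Polynomial (PowerSeries ℂ)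

/-- The composition `ε ∘ Q`, by the Leibniz rule `ε q = q ε + ε(q)`. -/
def eulerMul (Q : FormalOp) : FormalOp :=
  Q.sum fun l q => Polynomial.monomial (l + 1) q + Polynomial.monomial l (eulerDeriv q)

/-- The composition `P ∘ Q` of operators: `(∑ k, p_k ε^k) Q = ∑ k, p_k (ε^k Q)`. -/
def opMul (P Q : FormalOp) : FormalOp :=
  P.sum fun k p => Polynomial.C p * eulerMul^[k] Q

/-- A formal power series converges: its radius of convergence is positive.  The series with this
property are the Taylor series of the holomorphic germs at the origin. -/
def IsConvergent (f : PowerSeries ℂ) : Prop :=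
  0 < (FormalMultilinearSeries.ofScalars ℂ (fun k => PowerSeries.coeff k f)).radius

/-- Formal Fuchsian operators: the leading coefficient in `ε` does not vanish at `t = 0`. -/
def IsFormalFuchsian (P : FormalOp) : Prop :=
  PowerSeries.constantCoeff P.leadingCoeff ≠ 0

/-- (Analytic) Fuchsian operators: moreover all the coefficients are holomorphic at `t = 0`. -/
def IsFuchsian (P : FormalOp) : Prop :=
  IsFormalFuchsian P ∧ ∀ k, IsConvergent (P.coeff k)

/-- The action of an operator on formal power series: `(∑ k, p_k ε^k) f = ∑ k, p_k ε^k(f)`. -/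
def opAct (P : FormalOp) (f : PowerSeries ℂ) : PowerSeries ℂ :=
  P.sum fun k p => p * eulerDeriv^[k] f

theorem opAct_add (P Q : FormalOp) (f : PowerSeries ℂ) :
    opAct (P + Q) f = opAct P f + opAct Q f :=
  Polynomial.sum_add_index P Q _ (by simp) (by intros; ring)

theorem opAct_monomial (k : ℕ) (p f : PowerSeries ℂ) :
    opAct (Polynomial.monomial k p) f = p * eulerDeriv^[k] f :=
  Polynomial.sum_monomial_index p _ (by simp)

theorem opAct_sum {ι : Type*} (s : Finset ι) (F : ι → FormalOp) (f : PowerSeries ℂ) :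
    opAct (∑ i ∈ s, F i) f = ∑ i ∈ s, opAct (F i) f := by
  classical
  induction s using Finset.induction_on with
  | empty => simp [opAct]
  | insert a s ha ih => rw [Finset.sum_insert ha, Finset.sum_insert ha, opAct_add, ih]

theorem eulerDeriv_sum {ι : Type*} (s : Finset ι) (F : ι → PowerSeries ℂ) :
    eulerDeriv (∑ i ∈ s, F i) = ∑ i ∈ s, eulerDeriv (F i) := by
  simp [eulerDeriv, map_sum, Finset.mul_sum]

theorem opAct_eulerMul (Q : FormalOp) (f : PowerSeries ℂ) :
    opAct (eulerMul Q) f = eulerDeriv (opAct Q f) := by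
  unfold eulerMul
  rw [Polynomial.sum_def, opAct_sum]
  conv_rhs => rw [opAct, Polynomial.sum_def, eulerDeriv_sum]
  refine Finset.sum_congr rfl fun l _ => ?_
  rw [opAct_add, opAct_monomial, opAct_monomial, Function.iterate_succ_apply']
  simp only [eulerDeriv, Derivation.leibniz, smul_eq_mul]
  ring

theorem opAct_C_mul (p : PowerSeries ℂ) (Q : FormalOp) (f : PowerSeries ℂ) :
    opAct (Polynomial.C p * Q) f = p * opAct Q f := by
  induction Q using Polynomial.induction_on' with
  | add P Q hP hQ => rw [mul_add, opAct_add, opAct_add, hP, hQ, mul_add]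
  | monomial k q => rw [Polynomial.C_mul_monomial, opAct_monomial, opAct_monomial, mul_assoc]

/-- `opMul` is the composition of the operators acting on `ℂ⟦t⟧`. -/
theorem opAct_opMul (P Q : FormalOp) (f : PowerSeries ℂ) :
    opAct (opMul P Q) f = opAct P (opAct Q f) := by
  have h (k : ℕ) : opAct (eulerMul^[k] Q) f = eulerDeriv^[k] (opAct Q f) := by
    induction k with
    | zero => rfl
    | succ k ih => rw [Function.iterate_succ_apply', Function.iterate_succ_apply',
        opAct_eulerMul, ih]
  unfold opMul
  rw [Polynomial.sum_def, opAct_sum]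
  conv_rhs => rw [opAct, Polynomial.sum_def]
  exact Finset.sum_congr rfl fun k _ => by rw [opAct_C_mul, h]

end

/-! Let `N` be the module over the ring of convergent series spanned by the derivatives `ε^i(u_j)`
with `i, j < n`. Modulo `N`, the coefficient of `ε^m` in `MH` is `b_n ε^n(u_m)`, which vanishes for
`m ≥ n`. So the coefficients of `KL` in degrees at least `n` lie in `N`; they are triangular in the
`v_l` with the unit `a_n` on the diagonal, hence every `v_l` lies in `N`
(`coeff_mem_of_opMul_coeff_mem`). Then all coefficients of `KL = MH` lie in `N`, and dividing by the
unit `b_n` gives `ε^n(u_m) ∈ N`. Thus `N` is stable under `ε`: its generators solve a system `ε w =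
B w` with `B` convergent, and formal solutions of such a system converge
(`isConvergent_of_eulerDeriv_eq`). -/

/-! ### Convergent power series -/

open Filter in
-- The exponent `k + 1` lets one number `R` absorb the constant of the Cauchy estimate, and
-- "eventually" lets finitely many series share the same `R`.
theorem isConvergent_iff_eventually (f : PowerSeries ℂ) :
    IsConvergent f ↔ ∀ᶠ R : ℝ in atTop, ∀ k, ‖PowerSeries.coeff k f‖ ≤ R ^ (k + 1) := by
  unfold IsConvergent
  constructor
  · intro h
    obtain ⟨r, hr0, hr⟩ := ENNReal.lt_iff_exists_nnreal_btwn.1 h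
    obtain ⟨C, hC, hb⟩ := FormalMultilinearSeries.norm_mul_pow_le_of_lt_radius _ hr
    have hr0 : (0 : ℝ) < r := by exact_mod_cast hr0
    filter_upwards [eventually_ge_atTop C, eventually_ge_atTop ((r : ℝ)⁻¹)] with R h1 h2 k
    have hk := hb k
    rw [FormalMultilinearSeries.ofScalars_norm] at hk
    have hR : 0 < R := hC.trans_le h1
    calc ‖PowerSeries.coeff k f‖ ≤ C * (r : ℝ)⁻¹ ^ k := by
          rw [inv_pow, ← div_eq_mul_inv, le_div_iff₀ (by positivity)]; exact hk
      _ ≤ R * R ^ k := by gcongr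
      _ = R ^ (k + 1) := by ring
  · intro h
    obtain ⟨R, h, hR⟩ := (h.and (eventually_gt_atTop 0)).exists
    have : ((R.toNNReal⁻¹ : NNReal) : ENNReal) ≤ (FormalMultilinearSeries.ofScalars ℂ
        (fun k => PowerSeries.coeff k f)).radius := by
      refine FormalMultilinearSeries.le_radius_of_bound _ R fun k => ?_
      rw [FormalMultilinearSeries.ofScalars_norm, NNReal.coe_inv, Real.coe_toNNReal _ hR.le,
        inv_pow, ← div_eq_mul_inv, div_le_iff₀ (by positivity)]
      exact (h k).trans_eq (by ring)
    refine lt_of_lt_of_le ?_ this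
    simpa using hR

theorem isConvergent_of_bound {f : PowerSeries ℂ} (A S : ℝ)
    (h : ∀ k, ‖PowerSeries.coeff k f‖ ≤ A * S ^ k) : IsConvergent f := by
  rw [isConvergent_iff_eventually]
  filter_upwards [Filter.eventually_ge_atTop |A|, Filter.eventually_ge_atTop |S|] with R h1 h2 k
  calc ‖PowerSeries.coeff k f‖ ≤ |A * S ^ k| := (h k).trans (le_abs_self _)
    _ = |A| * |S| ^ k := by rw [abs_mul, abs_pow]
    _ ≤ R * R ^ k := by gcongr; exact (abs_nonneg _).trans h1
    _ = R ^ (k + 1) := by ring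

theorem IsConvergent.add {f g : PowerSeries ℂ} (hf : IsConvergent f) (hg : IsConvergent g) :
    IsConvergent (f + g) := by
  rw [isConvergent_iff_eventually] at hf hg
  obtain ⟨R, hf, hg⟩ := (hf.and hg).exists
  refine isConvergent_of_bound (2 * R) R fun k => ?_
  rw [map_add]
  exact (norm_add_le _ _).trans ((add_le_add (hf k) (hg k)).trans_eq (by ring))

theorem IsConvergent.mul {f g : PowerSeries ℂ} (hf : IsConvergent f) (hg : IsConvergent g) :
    IsConvergent (f * g) := by
  rw [isConvergent_iff_eventually] at hf hg
  obtain ⟨R, ⟨hf, hg⟩, hR⟩ := ((hf.and hg).and (Filter.eventually_gt_atTop 0)).exists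
  refine isConvergent_of_bound (R ^ 2) (2 * R) fun k => ?_
  rw [PowerSeries.coeff_mul]
  calc _ ≤ ∑ p ∈ Finset.HasAntidiagonal.antidiagonal k, R ^ (k + 2) := by
        refine norm_sum_le_of_le _ fun p hp => ?_
        rw [norm_mul, ← Finset.HasAntidiagonal.mem_antidiagonal.1 hp]
        calc _ ≤ R ^ (p.1 + 1) * R ^ (p.2 + 1) :=
              mul_le_mul (hf _) (hg _) (norm_nonneg _) (by positivity)
          _ = _ := by ring
    _ = ((k + 1 : ℕ) : ℝ) * R ^ (k + 2) := by simp
    _ ≤ ((2 ^ k : ℕ) : ℝ) * R ^ (k + 2) := by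
        gcongr
        exact Nat.lt_two_pow_self
    _ = _ := by push_cast; ring

theorem coeff_eulerDeriv (f : PowerSeries ℂ) (k : ℕ) :
    PowerSeries.coeff k (eulerDeriv f) = k * PowerSeries.coeff k f := by
  unfold eulerDeriv
  cases k with
  | zero => simp
  | succ k => rw [PowerSeries.coeff_succ_X_mul, PowerSeries.coeff_derivative]; push_cast; ring

theorem eulerDeriv_add (f g : PowerSeries ℂ) :
    eulerDeriv (f + g) = eulerDeriv f + eulerDeriv g := by
  simp [eulerDeriv, mul_add]

theorem eulerDeriv_zero : eulerDeriv 0 = 0 := by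
  simp [eulerDeriv]

theorem eulerDeriv_iterate_zero (k : ℕ) : eulerDeriv^[k] 0 = 0 :=
  Function.iterate_fixed eulerDeriv_zero k

theorem eulerDeriv_iterate_add (k : ℕ) (f g : PowerSeries ℂ) :
    eulerDeriv^[k] (f + g) = eulerDeriv^[k] f + eulerDeriv^[k] g := by
  induction k generalizing f g with
  | zero => rfl
  | succ k ih => rw [Function.iterate_succ_apply, eulerDeriv_add, ih]; rfl

theorem IsConvergent.eulerDeriv {f : PowerSeries ℂ} (hf : IsConvergent f) :
    IsConvergent (eulerDeriv f) := by
  rw [isConvergent_iff_eventually] at hf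
  obtain ⟨R, hf, hR⟩ := (hf.and (Filter.eventually_gt_atTop 0)).exists
  refine isConvergent_of_bound R (2 * R) fun k => ?_
  rw [coeff_eulerDeriv, norm_mul, Complex.norm_natCast]
  calc (k : ℝ) * _ ≤ ((2 ^ k : ℕ) : ℝ) * R ^ (k + 1) := by
        gcongr
        · exact Nat.lt_two_pow_self.le
        · exact hf k
    _ = _ := by push_cast; ring

theorem isConvergent_C (a : ℂ) : IsConvergent (PowerSeries.C a) := by
  refine isConvergent_of_bound ‖a‖ 1 fun k => ?_
  rw [PowerSeries.coeff_C]
  split_ifs <;> simp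

/-- The ring of convergent power series, i.e. of germs of holomorphic functions at the origin. -/
def convergentSubring : Subring (PowerSeries ℂ) where
  carrier := {f | IsConvergent f}
  mul_mem' := IsConvergent.mul
  one_mem' := by simpa using isConvergent_C 1
  add_mem' := IsConvergent.add
  zero_mem' := by simpa using isConvergent_C 0
  neg_mem' {f} hf := by simpa using (isConvergent_C (-1)).mul hf

/-! ### Majorants and regular singular systems -/

/-- Geometric growth of sequences dominated by a convolution with a geometric sequence. -/
theorem exists_geometric_bound {s : ℕ → ℝ} (hs : ∀ m, 0 ≤ s m) {C R : ℝ} (hC : 0 < C) (hR : 1 ≤ R)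
    (m₀ : ℕ) (h : ∀ m ≥ m₀, s m ≤ C * ∑ i ∈ Finset.range m, R ^ (m - i) * s i) :
    ∃ A S : ℝ, ∀ m, s m ≤ A * S ^ m := by
  set A := ∑ i ∈ Finset.range m₀, s i
  -- Chosen so that `S - R = C * R`, which makes the convolution sum telescope to `S ^ m - R ^ m`.
  set S := R * (1 + C)
  have hA : 0 ≤ A := Finset.sum_nonneg fun i _ => hs i
  have hS : 1 ≤ S := one_le_mul_of_one_le_of_one_le hR (by linarith)
  refine ⟨A, S, fun m => ?_⟩
  induction m using Nat.strong_induction_on with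
  | _ m ih =>
    rcases lt_or_ge m m₀ with hm | hm
    · calc s m ≤ A := Finset.single_le_sum (fun i _ => hs i) (Finset.mem_range.2 hm)
        _ ≤ A * S ^ m := le_mul_of_one_le_right hA (one_le_pow₀ hS)
    · have hgeom : C * ∑ i ∈ Finset.range m, R ^ (m - i) * S ^ i = S ^ m - R ^ m := by
        rw [← geom_sum₂_mul S R m, Finset.mul_sum, Finset.sum_mul]
        refine Finset.sum_congr rfl fun i hi => ?_
        have : m - i = (m - 1 - i) + 1 := by have := Finset.mem_range.1 hi; omega
        rw [this, pow_succ]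
        simp only [S]
        ring
      calc s m ≤ C * ∑ i ∈ Finset.range m, R ^ (m - i) * s i := h m hm
        _ ≤ C * ∑ i ∈ Finset.range m, R ^ (m - i) * (A * S ^ i) := by
            gcongr with i hi
            exact ih i (Finset.mem_range.1 hi)
        _ = A * (C * ∑ i ∈ Finset.range m, R ^ (m - i) * S ^ i) := by
            simp only [Finset.mul_sum]
            exact Finset.sum_congr rfl fun i _ => by ring
        _ ≤ A * S ^ m := by
            rw [hgeom]
            gcongr
            linarith [pow_nonneg (zero_le_one.trans hR) m]

theorem isConvergent_of_mul_eq_one {f g : PowerSeries ℂ} (hf : IsConvergent f) (hfg : f * g = 1) :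
    IsConvergent g := by
  rw [isConvergent_iff_eventually] at hf
  obtain ⟨R, hf, hR⟩ := (hf.and (Filter.eventually_ge_atTop 1)).exists
  have h0 : PowerSeries.coeff 0 f * PowerSeries.coeff 0 g = 1 := by
    simpa using congrArg (PowerSeries.constantCoeff (R := ℂ)) hfg
  have hf0 : PowerSeries.coeff 0 f ≠ 0 := left_ne_zero_of_mul_eq_one h0
  obtain ⟨A, S, hAS⟩ := exists_geometric_bound (s := fun m => ‖PowerSeries.coeff m g‖)
    (C := ‖PowerSeries.coeff 0 f‖⁻¹ * R) (fun m => norm_nonneg _)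
    (mul_pos (inv_pos.2 (norm_pos_iff.2 hf0)) (by linarith)) hR 1 (by
      intro m hm
      have h := congrArg (PowerSeries.coeff m) hfg
      rw [mul_comm, PowerSeries.coeff_mul, Finset.Nat.sum_antidiagonal_eq_sum_range_succ
        (fun i j => PowerSeries.coeff i g * PowerSeries.coeff j f), Finset.sum_range_succ,
        PowerSeries.coeff_one, if_neg (by omega), Nat.sub_self] at h
      have h' := eq_neg_of_add_eq_zero_right h
      have hn := congrArg norm h'
      rw [norm_neg, norm_mul] at hn
      rw [mul_assoc, inv_mul_eq_div, le_div_iff₀ (norm_pos_iff.2 hf0), hn, Finset.mul_sum]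
      refine norm_sum_le_of_le _ fun i _ => ?_
      rw [norm_mul]
      calc _ ≤ ‖PowerSeries.coeff i g‖ * R ^ (m - i + 1) := by gcongr; exact hf _
        _ = _ := by ring)
  exact isConvergent_of_bound A S hAS

/-- Formal solutions of a system of linear differential equations with a regular singular point
of the first kind converge. -/
theorem isConvergent_of_eulerDeriv_eq {ι : Type*} [Fintype ι] (w : ι → PowerSeries ℂ)
    (B : ι → ι → PowerSeries ℂ) (hB : ∀ i j, IsConvergent (B i j))
    (h : ∀ i, eulerDeriv (w i) = ∑ j, B i j * w j) (i : ι) : IsConvergent (w i) := by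
  have hB' : ∀ᶠ R : ℝ in Filter.atTop, ∀ i j k, ‖PowerSeries.coeff k (B i j)‖ ≤ R ^ (k + 1) := by
    simp only [isConvergent_iff_eventually] at hB
    exact Filter.eventually_all.2 fun i => Filter.eventually_all.2 fun j => hB i j
  obtain ⟨R, hB', hR⟩ := (hB'.and (Filter.eventually_ge_atTop 1)).exists
  set s : ℕ → ℝ := fun m => ∑ i, ‖PowerSeries.coeff m (w i)‖ with hs
  have hcard : 0 < (Fintype.card ι : ℝ) := by
    exact_mod_cast Fintype.card_pos_iff.2 ⟨i⟩
  set C : ℝ := Fintype.card ι * R with hC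
  have hs0 : ∀ m, 0 ≤ s m := fun m => Finset.sum_nonneg fun _ _ => norm_nonneg _
  have hrow : ∀ i (m : ℕ), (m : ℝ) * ‖PowerSeries.coeff m (w i)‖ ≤
      ∑ q ∈ Finset.range (m + 1), R ^ (m - q + 1) * s q := by
    intro i m
    have := congrArg (fun f => ‖PowerSeries.coeff m f‖) (h i)
    simp only [coeff_eulerDeriv, norm_mul, Complex.norm_natCast, map_sum] at this
    rw [this]
    simp only [hs, Finset.mul_sum]
    rw [Finset.sum_comm]
    refine norm_sum_le_of_le _ fun j _ => ?_
    rw [mul_comm, PowerSeries.coeff_mul, Finset.Nat.sum_antidiagonal_eq_sum_range_succ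
        (fun p q => PowerSeries.coeff p (w j) * PowerSeries.coeff q (B i j))]
    refine norm_sum_le_of_le _ fun q _ => ?_
    rw [norm_mul, mul_comm]
    gcongr
    exact hB' i j _
  have hsum : ∀ m : ℕ, (m : ℝ) * s m ≤
      C * s m + C * ∑ q ∈ Finset.range m, R ^ (m - q) * s q := by
    intro m
    calc (m : ℝ) * s m ≤ ∑ _i : ι, ∑ q ∈ Finset.range (m + 1), R ^ (m - q + 1) * s q := by
          rw [hs, Finset.mul_sum]
          exact Finset.sum_le_sum fun i _ => hrow i m
      _ = _ := by
          rw [Finset.sum_const, Finset.card_univ, nsmul_eq_mul, Finset.sum_range_succ,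
            Nat.sub_self, hC]
          simp only [pow_succ, mul_right_comm _ R, ← Finset.sum_mul]
          ring
  obtain ⟨A, S, hAS⟩ := exists_geometric_bound hs0 (C := C) (by positivity) hR
    (⌈C⌉₊ + 1) (by
      intro m hm
      -- The diagonal term `C * s m` is absorbed on the left once `m - C ≥ 1`; the finitely many
      -- smaller `m`, where resonances may occur, do not affect convergence.
      have h1 : C + 1 ≤ m :=
        (add_le_add_left (Nat.le_ceil C) 1).trans (by exact_mod_cast hm)
      have h2 := mul_le_mul_of_nonneg_right h1 (hs0 m)
      linarith [hsum m])
  exact isConvergent_of_bound A S fun k => (Finset.single_le_sum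
    (f := fun i => ‖PowerSeries.coeff k (w i)‖) (fun _ _ => norm_nonneg _)
    (Finset.mem_univ i)).trans (hAS k)

theorem isConvergent_of_eulerDeriv_mem_span {ι : Type*} [Fintype ι] (w : ι → PowerSeries ℂ)
    (h : ∀ i, eulerDeriv (w i) ∈ Submodule.span convergentSubring (Set.range w)) (i : ι) :
    IsConvergent (w i) := by
  choose B hB using fun i => (Submodule.mem_span_range_iff_exists_fun _).1 (h i)
  exact isConvergent_of_eulerDeriv_eq w (fun i j => B i j) (fun i j => (B i j).2)
    (fun i => (hB i).symm) i

/-! ### Coefficients of a composition -/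

theorem coeff_eulerMul_zero (Q : FormalOp) :
    (eulerMul Q).coeff 0 = eulerDeriv (Q.coeff 0) := by
  rw [eulerMul, Polynomial.sum_def, Polynomial.finsetSum_coeff]
  simp only [Polynomial.coeff_add, Polynomial.coeff_monomial, Nat.succ_ne_zero, if_false, zero_add]
  rw [Finset.sum_ite_eq', ite_eq_left_iff, Polynomial.notMem_support_iff]
  intro h
  rw [h, eulerDeriv_zero]

theorem coeff_eulerMul_succ (Q : FormalOp) (m : ℕ) :
    (eulerMul Q).coeff (m + 1) = Q.coeff m + eulerDeriv (Q.coeff (m + 1)) := by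
  rw [eulerMul, Polynomial.sum_def, Polynomial.finsetSum_coeff]
  simp only [Polynomial.coeff_add, Polynomial.coeff_monomial, add_left_inj]
  rw [Finset.sum_add_distrib, Finset.sum_ite_eq', Finset.sum_ite_eq']
  congr 1
  · rw [ite_eq_left_iff, Polynomial.notMem_support_iff]
    exact fun h => h.symm
  · rw [ite_eq_left_iff, Polynomial.notMem_support_iff]
    intro h
    rw [h, eulerDeriv_zero]

theorem coeff_opMul (P Q : FormalOp) {d : ℕ} (hd : P.natDegree ≤ d) (m : ℕ) :
    (opMul P Q).coeff m =
      ∑ k ∈ Finset.range (d + 1), P.coeff k * (eulerMul^[k] Q).coeff m := by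
  rw [opMul, Polynomial.sum_over_range' _ (by simp) (d + 1) (Nat.lt_succ_of_le hd),
    Polynomial.finsetSum_coeff]
  simp only [Polynomial.coeff_C_mul]

theorem isConvergent_coeff_eulerMul_iterate {Q : FormalOp} (hQ : ∀ m, IsConvergent (Q.coeff m))
    (k m : ℕ) : IsConvergent ((eulerMul^[k] Q).coeff m) := by
  induction k generalizing m with
  | zero => exact hQ m
  | succ k ih =>
    rw [Function.iterate_succ_apply']
    cases m with
    | zero => rw [coeff_eulerMul_zero]; exact (ih 0).eulerDeriv
    | succ m => rw [coeff_eulerMul_succ]; exact (ih m).add (ih (m + 1)).eulerDeriv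

theorem coeff_eulerMul_iterate_eq_zero {Q : FormalOp} {k m : ℕ} (h : Q.natDegree + k < m) :
    (eulerMul^[k] Q).coeff m = 0 := by
  induction k generalizing m with
  | zero => exact Polynomial.coeff_eq_zero_of_natDegree_lt h
  | succ k ih =>
    obtain ⟨m, rfl⟩ := Nat.exists_eq_succ_of_ne_zero (Nat.ne_zero_of_lt h)
    rw [Function.iterate_succ_apply', coeff_eulerMul_succ, ih (by omega), ih (by omega),
      eulerDeriv_zero, add_zero]

theorem coeff_eulerMul_iterate_natDegree_add (Q : FormalOp) (k : ℕ) :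
    (eulerMul^[k] Q).coeff (Q.natDegree + k) = Q.leadingCoeff := by
  induction k with
  | zero => rfl
  | succ k ih =>
    rw [Function.iterate_succ_apply', ← add_assoc, coeff_eulerMul_succ, ih,
      coeff_eulerMul_iterate_eq_zero (Nat.lt_succ_self _), eulerDeriv_zero, add_zero]

/-- Leibniz: `ε^k ∘ Q` has the coefficients `ε^k(q_m)` modulo the derivatives of lower order. -/
theorem coeff_eulerMul_iterate_sub_mem (N : AddSubgroup (PowerSeries ℂ)) (k : ℕ) (Q : FormalOp)
    (h : ∀ i < k, ∀ j, eulerDeriv^[i] (Q.coeff j) ∈ N) (m : ℕ) :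
    (eulerMul^[k] Q).coeff m - eulerDeriv^[k] (Q.coeff m) ∈ N := by
  induction k generalizing Q m with
  | zero => simp
  | succ k ih =>
    have hstep := ih (eulerMul Q) (fun i hi j => by
      cases j with
      | zero =>
        rw [coeff_eulerMul_zero, ← Function.iterate_succ_apply]
        exact h _ (by omega) _
      | succ j =>
        rw [coeff_eulerMul_succ, eulerDeriv_iterate_add, ← Function.iterate_succ_apply]
        exact N.add_mem (h _ (by omega) _) (h _ (by omega) _)) m
    rw [Function.iterate_succ_apply, Function.iterate_succ_apply]
    cases m with
    | zero => rwa [coeff_eulerMul_zero] at hstep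
    | succ m =>
      rw [coeff_eulerMul_succ, eulerDeriv_iterate_add] at hstep
      have := N.add_mem hstep (h k (Nat.lt_succ_self k) m)
      convert this using 1
      ring

/-! ### Membership of coefficients in the module `N` -/

theorem mem_of_isConvergent_unit_mul_mem (N : Submodule convergentSubring (PowerSeries ℂ))
    {a f : PowerSeries ℂ} (ha : IsConvergent a) (ha0 : PowerSeries.constantCoeff a ≠ 0)
    (h : a * f ∈ N) : f ∈ N := by
  have hinv : a * a⁻¹ = 1 := PowerSeries.mul_inv_cancel a ha0
  have := N.smul_mem (⟨a⁻¹, isConvergent_of_mul_eq_one ha hinv⟩ : convergentSubring) h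
  rwa [Subring.smul_def, smul_eq_mul, ← mul_assoc, mul_comm a⁻¹, hinv, one_mul] at this

theorem mul_mem_of_isConvergent (N : Submodule convergentSubring (PowerSeries ℂ))
    {a f : PowerSeries ℂ} (ha : IsConvergent a) (h : f ∈ N) : a * f ∈ N :=
  N.smul_mem (⟨a, ha⟩ : convergentSubring) h

section Conjugation

variable {n : ℕ} {L M H K : FormalOp} (N : Submodule convergentSubring (PowerSeries ℂ))

theorem coeff_opMul_sub_mem (hM : ∀ k, IsConvergent (M.coeff k)) (hMn : M.natDegree = n)
    (hN : ∀ i < n, ∀ j, eulerDeriv^[i] (H.coeff j) ∈ N) (m : ℕ) :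
    (opMul M H).coeff m - M.leadingCoeff * eulerDeriv^[n] (H.coeff m) ∈ N := by
  have hlow : ∀ k ≤ n, (eulerMul^[k] H).coeff m - eulerDeriv^[k] (H.coeff m) ∈ N := fun k hk =>
    coeff_eulerMul_iterate_sub_mem N.toAddSubgroup k H (fun i hi j => hN i (by omega) j) m
  rw [coeff_opMul M H hMn.le, Finset.sum_range_succ, add_sub_assoc, Polynomial.leadingCoeff, hMn,
    ← mul_sub]
  refine N.add_mem (N.sum_mem fun k hk => mul_mem_of_isConvergent N (hM k) ?_)
    (mul_mem_of_isConvergent N (hM n) (hlow n le_rfl))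
  have hk := Finset.mem_range.1 hk
  simpa using N.add_mem (hlow k hk.le) (hN k hk m)

/-- In degree `L.natDegree + l` the terms of `K` with `k < l` contribute nothing, `k = l`
contributes `K.coeff l` times a unit, and those with `k > l` are already in `N`. -/
theorem coeff_mem_of_opMul_coeff_mem (hL : IsFuchsian L)
    (h : ∀ m, L.natDegree ≤ m → (opMul K L).coeff m ∈ N) (l : ℕ) : K.coeff l ∈ N := by
  -- Descending induction on `l`, starting above the degree of `K`.
  obtain ⟨d, hd⟩ : ∃ d, d = K.natDegree + 1 - l := ⟨_, rfl⟩
  induction d using Nat.strong_induction_on generalizing l with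
  | _ d ih =>
    rcases lt_or_ge K.natDegree l with hl | hl
    · rw [Polynomial.coeff_eq_zero_of_natDegree_lt hl]
      exact N.zero_mem
    · refine mem_of_isConvergent_unit_mul_mem N (a := L.leadingCoeff) (hL.2 _) hL.1 ?_
      have htop := h (L.natDegree + l) (Nat.le_add_right _ _)
      rw [coeff_opMul K L le_rfl, ← Finset.add_sum_erase _ _ (Finset.mem_range.2 (by omega) :
        l ∈ Finset.range (K.natDegree + 1)), coeff_eulerMul_iterate_natDegree_add] at htop
      rw [mul_comm]
      refine (N.add_mem_iff_left (N.sum_mem fun k hk => ?_)).1 htop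
      rw [Finset.mem_erase, Finset.mem_range] at hk
      rcases lt_or_gt_of_ne hk.1 with hkl | hkl
      · rw [coeff_eulerMul_iterate_eq_zero (by omega), mul_zero]
        exact N.zero_mem
      · rw [mul_comm]
        exact mul_mem_of_isConvergent N (isConvergent_coeff_eulerMul_iterate hL.2 k _)
          (ih _ (by omega) k rfl)

end Conjugation

/-! ### Convergence of the conjugating operators -/

theorem theorem8 (n : ℕ) (L M H K : FormalOp)
    (hL : IsFuchsian L) (hLn : L.natDegree = n)
    (hM : IsFuchsian M) (hMn : M.natDegree = n)
    (hH : IsFormalFuchsian H) (hHn : H.natDegree < n)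
    (hK : IsFormalFuchsian K) (hKn : K.natDegree < n)
    (hconj : opMul M H = opMul K L) :
    ((∀ k, IsConvergent (H.coeff k)) ∧ (∀ k, IsConvergent (K.coeff k))) ∧
      IsFuchsian H ∧ IsFuchsian K := by
  have hH0 : ∀ j, n ≤ j → H.coeff j = 0 := fun j hj =>
    Polynomial.coeff_eq_zero_of_natDegree_lt (by omega)
  set w : Fin n × Fin n → PowerSeries ℂ := fun p => eulerDeriv^[p.1] (H.coeff p.2) with hw
  set N := Submodule.span convergentSubring (Set.range w) with hNdef
  have hN : ∀ i < n, ∀ j, eulerDeriv^[i] (H.coeff j) ∈ N := by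
    intro i hi j
    rcases lt_or_ge j n with hj | hj
    · exact Submodule.subset_span ⟨(⟨i, hi⟩, ⟨j, hj⟩), rfl⟩
    · rw [hH0 j hj, eulerDeriv_iterate_zero]
      exact N.zero_mem
  have hdiff := coeff_opMul_sub_mem N hM.2 hMn hN
  have hKN : ∀ l, K.coeff l ∈ N := by
    refine coeff_mem_of_opMul_coeff_mem N hL fun m hm => ?_
    have := hdiff m
    rwa [hH0 m (by omega), eulerDeriv_iterate_zero, mul_zero, sub_zero, hconj] at this
  have hprod : ∀ m, (opMul M H).coeff m ∈ N := by
    intro m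
    rw [hconj, coeff_opMul K L le_rfl]
    refine N.sum_mem fun k _ => ?_
    rw [mul_comm]
    exact mul_mem_of_isConvergent N (isConvergent_coeff_eulerMul_iterate hL.2 k m) (hKN k)
  have hNn : ∀ i ≤ n, ∀ j, eulerDeriv^[i] (H.coeff j) ∈ N := by
    intro i hi j
    rcases hi.lt_or_eq with hi | rfl
    · exact hN i hi j
    · exact mem_of_isConvergent_unit_mul_mem N (a := M.leadingCoeff) (hM.2 _) hM.1
        ((N.sub_mem_iff_right (hprod j)).1 (hdiff j))
  -- Applying `ε` to a generator raises `i < n` to at most `n`, so the result is still in `N`.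
  have hconv : ∀ p, IsConvergent (w p) := isConvergent_of_eulerDeriv_mem_span w fun p => by
    rw [hw, ← Function.iterate_succ_apply' eulerDeriv]
    exact hNn _ p.1.2 _
  have hNle : ∀ f ∈ N, IsConvergent f := by
    intro f hf
    induction hf using Submodule.span_induction with
    | mem f hf => obtain ⟨p, rfl⟩ := hf; exact hconv p
    | zero => exact convergentSubring.zero_mem
    | add f g _ _ hf hg => exact hf.add hg
    | smul a f _ hf => exact a.2.mul hf
  have hHc : ∀ k, IsConvergent (H.coeff k) := fun k => hNle _ (hNn 0 (Nat.zero_le _) k)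
  have hKc : ∀ k, IsConvergent (K.coeff k) := fun k => hNle _ (hKN k)
  exact ⟨⟨hHc, hKc⟩, ⟨hH, hHc⟩, ⟨hK, hKc⟩⟩
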